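/- **Lemma (dual cone of $\mathcal T_k$ and separability).** Write $\mathcal D(\mathcal K)$ for the set of density operators (positive semidefinite, trace one) on a finite-dimensional Hilbert space $\mathcal K$. Let $\phi_2=\frac12\sum_{i,j=0}^1|ii\rangle\langle jj|$ on $\mathbb C^2\otimes\mathbb C^2$. For a state $\rho$ on $\mathcal K_A\otimes\mathcal K_B$ put $$F_2(\rho)=\sup_{A,B}\frac{\operatorname{tr}[(A\otimes B)^\dagger\rho(A\otimes B)\phi_2]}{\operatorname{tr}[(A\otimes B)^\dagger\rho(A\otimes B)]},$$ the supremum being over linear maps $A:\mathbb C^2\to\mathcal K_A$, $B:\mathbb C^2\to\mathcal K_B$ with non-zero denominator; $\rho$ is single-copy undistillable if $F_2(\rho)=\frac12$. Let $d,k\ge 1$ and $\mathcal H=\mathbb C^{2d}\otimes\mathbb C^{2d}=(\mathbb C^d\otimes\mathbb C^2)\otimes(\mathbb C^d\otimes\mathbb C^2)$. Let $\mathcal T_k\subset\mathcal D(\mathcal H)$ be the set of copy-correlated $k$-undistillable states, i.e. of all states $\rho$ on $\mathcal H$ for which there is a state $\omega$ on $\mathcal H^{\otimes k}$ such that 1.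 $P_\pi\,\omega\, P_\pi^\dagger=\omega$ for all $\pi\in S_k$, where $P_\pi$ permutes the $k$ factors $\mathcal H$; 2. $\omega$ is single-copy undistillable with respect to the bipartition $(\mathbb C^{2d})^{\otimes k}\otimes(\mathbb C^{2d})^{\otimes k}$ that collects all first tensor factors of the $k$ copies of $\mathcal H$ on one side and all second ones on the other; 3. the partial trace of $\omega$ over all copies of $\mathcal H$ but the first is $\rho$. Let $(\mathcal T_k)^*=\{X=X^\dagger \text{ on }\mathcal H:\ \operatorname{tr}[X\rho]\ge 0\ \text{for all }\rho\in\mathcal T_k\}$ be its dual cone. Let $\sigma\in\mathcal D(\mathbb C^d\otimes\mathbb C^d)$. If $$\sigma\otimes\left(\tfrac12\mathbb I_4-\phi_2\right)\in(\mathcal T_k)^*,$$ where the two factors $\mathbb C^d$ of $\sigma$ and the two qubits are distributed over the two sides of $\mathcal H$ as indicated above, then $\sigma$ is separable, i.e. a convex combination of product states $\rho_A\otimes\rho_B$ with $\rho_A,\rho_B\in\mathcal D(\mathbb C^d)$. -/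

import Mathlib

open scoped Kronecker ComplexOrder

noncomputable section

namespace CopyCorrelated

/-- Density operators on the Hilbert space with orthonormal basis indexed by `κ`. -/
def IsState {κ : Type*} [Fintype κ] (ρ : Matrix κ κ ℂ) : Prop :=
  ρ.PosSemidef ∧ ρ.trace = 1

/-- Separable bipartite states: convex combinations of product states. -/
def IsSeparable {α β : Type*} [Fintype α] [Fintype β]
    (ρ : Matrix (α × β) (α × β) ℂ) : Prop :=
  ρ ∈ convexHull ℝ {τ : Matrix (α × β) (α × β) ℂ |
    ∃ (ρA : Matrix α α ℂ) (ρB : Matrix β β ℂ), IsState ρA ∧ IsState ρB ∧ τ = ρA ⊗ₖ ρB}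

/-- The projector `φ₂ = ½ ∑ i j, |i i⟩⟨j j|` onto the two-qubit maximally entangled state. -/
def phi2 : Matrix (Fin 2 × Fin 2) (Fin 2 × Fin 2) ℂ :=
  Matrix.of fun x y => if x.1 = x.2 ∧ y.1 = y.2 then 1 / 2 else 0

/-- The unnormalised two-qubit operator `(A ⊗ B)† ρ (A ⊗ B)`. -/
def filtered {α β : Type*} [Fintype α] [Fintype β] (ρ : Matrix (α × β) (α × β) ℂ)
    (A : Matrix α (Fin 2) ℂ) (B : Matrix β (Fin 2) ℂ) :
    Matrix (Fin 2 × Fin 2) (Fin 2 × Fin 2) ℂ :=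
  (A ⊗ₖ B).conjTranspose * ρ * (A ⊗ₖ B)

/-- The SLOCC singlet fraction `F₂`; the supremum runs over the local filters that succeed with
non-zero probability. -/
def singletFraction {α β : Type*} [Fintype α] [Fintype β]
    (ρ : Matrix (α × β) (α × β) ℂ) : ℝ :=
  sSup {r : ℝ | ∃ (A : Matrix α (Fin 2) ℂ) (B : Matrix β (Fin 2) ℂ),
    (filtered ρ A B).trace ≠ 0 ∧
      r = (filtered ρ A B * phi2).trace.re / (filtered ρ A B).trace.re}

/-- The set `𝒞₁` of single-copy undistillable states of a bipartite system. -/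
def singleCopyUndistillable (α β : Type*) [Fintype α] [Fintype β] :
    Set (Matrix (α × β) (α × β) ℂ) :=
  {ρ | IsState ρ ∧ singletFraction ρ = 1 / 2}

/-- The unitary on the `k`-fold tensor power that permutes the `k` tensor factors:
`P_π |g₀ … g_{k-1}⟩ = |g_{π⁻¹ 0} … g_{π⁻¹ (k-1)}⟩`. -/
def permOp {κ : Type*} [DecidableEq κ] {k : ℕ} (π : Equiv.Perm (Fin k)) :
    Matrix (Fin k → κ) (Fin k → κ) ℂ :=
  Matrix.of fun f g => if f = g ∘ π.symm then 1 else 0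

/-- The set `𝒮_k` of permutation-symmetric states on the `k`-fold tensor power. -/
def symmetricStates (κ : Type*) [Fintype κ] [DecidableEq κ] (k : ℕ) :
    Set (Matrix (Fin k → κ) (Fin k → κ) ℂ) :=
  {ω | IsState ω ∧ ∀ π : Equiv.Perm (Fin k), permOp π * ω * (permOp π).conjTranspose = ω}

/-- Partial trace over all tensor factors but the `m`-th: the sum runs over the multi-indices `f`
with `f m = x`, and the column index differs from `f` in the `m`-th place only. -/
def marginal {κ : Type*} [Fintype κ] [DecidableEq κ] {k : ℕ} (m : Fin k)
    (ω : Matrix (Fin k → κ) (Fin k → κ) ℂ) : Matrix κ κ ℂ :=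
  Matrix.of fun x y =>
    ∑ f : Fin k → κ, if f m = x then ω f (Function.update f m y) else 0

/-- A `k`-copy operator on `(ℂ^ι ⊗ ℂ^ι)^{⊗ k}` read as a bipartite operator, with all first
factors on one side and all second factors on the other. -/
def acrossParties {ι : Type*} {k : ℕ}
    (ω : Matrix (Fin k → ι × ι) (Fin k → ι × ι) ℂ) :
    Matrix ((Fin k → ι) × (Fin k → ι)) ((Fin k → ι) × (Fin k → ι)) ℂ :=
  Matrix.of fun f g => ω (fun i => (f.1 i, f.2 i)) (fun i => (g.1 i, g.2 i))

/-- The set `𝒯_k` of copy-correlated `k`-undistillable states on `ℂ^ι ⊗ ℂ^ι`, for `k ≥ 1`. -/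
def copyCorrelatedUndistillable (ι : Type*) [Fintype ι] [DecidableEq ι] (k : ℕ) [NeZero k] :
    Set (Matrix (ι × ι) (ι × ι) ℂ) :=
  {ρ | IsState ρ ∧ ∃ ω ∈ symmetricStates (ι × ι) k,
    acrossParties ω ∈ singleCopyUndistillable (Fin k → ι) (Fin k → ι) ∧ marginal 0 ω = ρ}

/-- The dual cone of a set of states, inside the real space of Hermitian operators. -/
def dualCone {κ : Type*} [Fintype κ] (S : Set (Matrix κ κ ℂ)) : Set (Matrix κ κ ℂ) :=
  {X | X.IsHermitian ∧ ∀ ρ ∈ S, 0 ≤ (X * ρ).trace.re}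

/-- The tensor product of an operator on `ℂ^α ⊗ ℂ^β` with one on `ℂ^α' ⊗ ℂ^β'`, as a bipartite
operator on `(ℂ^α ⊗ ℂ^α') ⊗ (ℂ^β ⊗ ℂ^β')`. -/
def bipartiteTensor {α β α' β' : Type*} (X : Matrix (α × β) (α × β) ℂ)
    (Y : Matrix (α' × β') (α' × β') ℂ) :
    Matrix ((α × α') × (β × β')) ((α × α') × (β × β')) ℂ :=
  Matrix.reindex (Equiv.prodProdProdComm α β α' β') (Equiv.prodProdProdComm α β α' β') (X ⊗ₖ Y)

end CopyCorrelated

end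

/-! Write `X` for `σ ⊗ (½ 𝟙 - φ₂)`. First, `k` copies reduce to one. Put a single-copy undistillable
`ρ` into a uniformly random copy, all other copies being in a product basis state `c`. This is
copy-correlated undistillable with marginal `k⁻¹ ρ + (1 - k⁻¹) |c⟩⟨c|`, and `X` does not see `c` if
both qubits of `c` are in state `0`. Hence `X` is nonnegative on every such `ρ`
(`marginal_mixedCopies_mem`, `trace_mul_marginal_mixedCopies`).

Since `½ 𝟙 - φ₂` is the partial transpose of the singlet projector, Hahn–Banach duality makes `X` a
convex combination of states and of partial transposes of `|w⟩⟨w|` with `w` a unit vector of Schmidt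
rank at most two (`mem_convexHull_dualGenerators`).

The functional `tr[Y (𝟙 ⊗ (𝟙 + 2 φ₂))]` vanishes on `X`, is at least one on states, and measures the
qubit-symmetric part of `w` on the other generators. So only vectors `w = v ⊗ ε` with `ε`
antisymmetric survive; the rank bound forces `v` to be a product vector, and tracing out the qubits
writes `σ` as a mixture of product states. -/

open scoped Kronecker ComplexOrder
open Matrix

/-! ### Convex geometry and trace separation -/

/-- In a finite-dimensional space, the convex hull of a compact set is compact. -/
theorem isCompact_convexHull_of_finiteDimensional {E : Type*} [AddCommGroup E] [Module ℝ E]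
    [TopologicalSpace E] [IsTopologicalAddGroup E] [ContinuousSMul ℝ E] [FiniteDimensional ℝ E]
    {s : Set E} (hs : IsCompact s) : IsCompact (convexHull ℝ s) := by
  rcases s.eq_empty_or_nonempty with rfl | ⟨z₀, hz₀⟩
  · simp
  let N := Module.finrank ℝ E + 1
  have himage : convexHull ℝ s = (fun p : (Fin N → ℝ) × (Fin N → E) => ∑ i, p.1 i • p.2 i) ''
      (stdSimplex ℝ (Fin N) ×ˢ Set.univ.pi fun _ => s) := by
    apply Set.Subset.antisymm
    · intro x hx
      obtain ⟨ι, _, z, w, hzs, hz, hw, hw1, rfl⟩ := eq_pos_convex_span_of_mem_convexHull hx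
      -- Carathéodory: affinely independent points number at most dimension plus one. Shorter
      -- combinations are padded with weight `0` at `z₀`, so one compact parameter space serves all
      -- points.
      have hcard : Fintype.card ι ≤ Fintype.card (Fin N) := by
        rw [Fintype.card_fin]
        exact hz.card_le_finrank_succ.trans
          (Nat.add_le_add_right (Submodule.finrank_le _) 1)
      obtain ⟨e⟩ := Function.Embedding.nonempty_of_card_le hcard
      refine ⟨(Function.extend e w 0, Function.extend e z fun _ => z₀), ⟨⟨?_, ?_⟩, ?_⟩, ?_⟩
      · intro j
        by_cases hj : ∃ i, e i = j
        · obtain ⟨i, rfl⟩ := hj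
          simpa [e.injective.extend_apply] using (hw i).le
        · simp [Function.extend_apply' _ _ _ hj]
      · rw [← hw1]
        refine (Finset.sum_of_injOn e e.injective.injOn (by simp) ?_ ?_).symm
        · intro j _ hj
          exact Function.extend_apply' _ _ _ (by simpa using hj)
        · intro i _
          simp [e.injective.extend_apply]
      · intro j _
        by_cases hj : ∃ i, e i = j
        · obtain ⟨i, rfl⟩ := hj
          simpa [e.injective.extend_apply] using hzs ⟨i, rfl⟩
        · simpa [Function.extend_apply' _ _ _ hj] using hz₀
      · refine (Finset.sum_of_injOn e e.injective.injOn (by simp) ?_ ?_).symm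
        · intro j _ hj
          have : Function.extend e w 0 j = 0 :=
            Function.extend_apply' _ _ _ (by simpa using hj)
          simp [this]
        · intro i _
          simp [e.injective.extend_apply]
    · rintro _ ⟨⟨w, z⟩, ⟨⟨hw0, hw1⟩, hz⟩, rfl⟩
      exact mem_convexHull_of_exists_fintype w z hw0 hw1 (fun i => hz i trivial) rfl
  rw [himage]
  refine ((isCompact_stdSimplex ℝ (Fin N)).prod (isCompact_univ_pi fun _ => hs)).image ?_
  fun_prop

/-- A point of a convex hull on which a functional attains its minimum `0` is a convex combination
of generators on which the functional vanishes. -/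
theorem mem_convexHull_inter_zero {E : Type*} [AddCommGroup E] [Module ℝ E] {s : Set E}
    (f : E →ₗ[ℝ] ℝ) (hf : ∀ y ∈ s, 0 ≤ f y) {x : E} (hx : x ∈ convexHull ℝ s) (hfx : f x = 0) :
    x ∈ convexHull ℝ (s ∩ {y | f y = 0}) := by
  obtain ⟨ι, _, w, z, hw, hw1, hz, rfl⟩ := mem_convexHull_iff_exists_fintype.1 hx
  have hzero : ∀ i, w i = 0 ∨ f (z i) = 0 := by
    have : ∑ i, w i * f (z i) = 0 := by simpa using hfx
    rw [Finset.sum_eq_zero_iff_of_nonneg fun i _ => mul_nonneg (hw i) (hf _ (hz i))] at this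
    exact fun i => mul_eq_zero.1 (this i (Finset.mem_univ i))
  rw [← Finset.centerMass_eq_of_sum_1 _ _ hw1, ← Finset.centerMass_filter_ne_zero]
  refine Finset.centerMass_mem_convexHull _ (fun i _ => hw i) ?_ ?_
  · rw [Finset.sum_filter_ne_zero, hw1]
    exact one_pos
  · intro i hi
    exact ⟨hz i, (hzero i).resolve_left (Finset.mem_filter.1 hi).2⟩

/-- A Hermitian matrix outside a closed convex set of Hermitian matrices is separated from it by
the trace pairing with a Hermitian matrix. -/
theorem exists_isHermitian_trace_separation {κ : Type*} [Fintype κ] [DecidableEq κ]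
    {t : Set (Matrix κ κ ℂ)} (ht : Convex ℝ t) (hc : IsClosed t)
    (hH : ∀ Y ∈ t, Y.IsHermitian) {X : Matrix κ κ ℂ} (hX : X.IsHermitian) (hXt : X ∉ t) :
    ∃ (H : Matrix κ κ ℂ) (u : ℝ), H.IsHermitian ∧ (H * X).trace.re < u ∧
      ∀ Y ∈ t, u < (H * Y).trace.re := by
  have : LocallyConvexSpace ℝ (Matrix κ κ ℂ) :=
    inferInstanceAs (LocallyConvexSpace ℝ (κ → κ → ℂ))
  obtain ⟨f, u, hfX, hft⟩ := geometric_hahn_banach_point_closed ht hc hXt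
  let g : Matrix κ κ ℂ →ₗ[ℝ] ℝ := f.toLinearMap
  -- The entries are chosen so that the real part of the trace pairing recovers the values of `g` on
  -- the real basis `E_ij`, `i E_ij`.
  let K : Matrix κ κ ℂ := of fun j i =>
    ⟨g (Matrix.single i j 1), - g (Matrix.single i j Complex.I)⟩
  have hg : ∀ Y, g Y = (K * Y).trace.re := by
    intro Y
    have hY : Y = ∑ i, ∑ j, ((Y i j).re • Matrix.single i j (1 : ℂ) +
        (Y i j).im • Matrix.single i j Complex.I) := by
      conv_lhs => rw [matrix_eq_sum_single Y]
      refine Finset.sum_congr rfl fun i _ => Finset.sum_congr rfl fun j _ => ?_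
      simp [smul_single, ← single_add, Complex.re_add_im]
    conv_lhs => rw [hY]
    simp only [map_sum, map_add, map_smul, smul_eq_mul, trace, diag_apply, mul_apply,
      Complex.re_sum, Complex.mul_re]
    rw [Finset.sum_comm]
    refine Finset.sum_congr rfl fun j _ => Finset.sum_congr rfl fun i _ => ?_
    simp only [K, of_apply]
    ring
  -- Against Hermitian matrices only the Hermitian part of `K` contributes to the real part.
  have hK : ∀ Y : Matrix κ κ ℂ, Y.IsHermitian →
      ((((1 / 2 : ℝ) • (K + Kᴴ)) * Y).trace).re = g Y := by
    intro Y hY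
    have : (Kᴴ * Y).trace = star (K * Y).trace := by
      rw [← trace_conjTranspose, conjTranspose_mul, hY.eq, trace_mul_comm]
    rw [hg, smul_mul_assoc, trace_smul, add_mul, trace_add, this, Complex.real_smul,
      Complex.re_ofReal_mul]
    simp
    ring
  refine ⟨(1 / 2 : ℝ) • (K + Kᴴ), u, ?_, ?_, ?_⟩
  · simp [IsHermitian, conjTranspose_smul, add_comm]
  · rw [hK X hX]
    exact hfX
  · intro Y hY
    rw [hK Y (hH Y hY)]
    exact hft Y hY

namespace CopyCorrelated

/-- The witness `½ 𝟙 - φ₂` of two-qubit singlet fraction above one half. -/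
noncomputable def singletWitness : Matrix (Fin 2 × Fin 2) (Fin 2 × Fin 2) ℂ := (1 / 2 : ℂ) • 1 - phi2

/-- The antisymmetric form on `ℂ²`. -/
noncomputable def antisymForm : Matrix (Fin 2) (Fin 2) ℂ := !![0, 1; -1, 0]

/-! ### Partial transposes of rank-one operators -/

section

variable {α β : Type*}

/-- The partial transpose, on the first factor, of `|w⟩⟨w|`, where `w` is a vector of `ℂ^α ⊗ ℂ^β`
written as a matrix. -/
def partialTransposeRankOne (w : Matrix α β ℂ) : Matrix (α × β) (α × β) ℂ :=
  of fun x y => w y.1 x.2 * star (w x.1 y.2)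

theorem partialTransposeRankOne_isHermitian (w : Matrix α β ℂ) :
    (partialTransposeRankOne w).IsHermitian := by
  ext x y
  simp [partialTransposeRankOne, mul_comm]

theorem trace_partialTransposeRankOne [Fintype α] [Fintype β] (w : Matrix α β ℂ) :
    (partialTransposeRankOne w).trace = ((∑ i, ∑ j, ‖w i j‖ ^ 2 : ℝ) : ℂ) := by
  simp [trace, partialTransposeRankOne, Fintype.sum_prod_type, Complex.mul_conj']

theorem partialTransposeRankOne_smul (c : ℝ) (w : Matrix α β ℂ) :
    partialTransposeRankOne (c • w) = (c ^ 2) • partialTransposeRankOne w := by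
  ext x y
  simp [partialTransposeRankOne]
  ring

theorem continuous_partialTransposeRankOne :
    Continuous (partialTransposeRankOne : Matrix α β ℂ → _) := by
  refine continuous_matrix fun x y => ?_
  simp only [partialTransposeRankOne, of_apply]
  fun_prop

theorem trace_filtered_mul [Fintype α] [Fintype β] (ρ : Matrix (α × β) (α × β) ℂ) (A : Matrix α (Fin 2) ℂ)
    (B : Matrix β (Fin 2) ℂ) (Y : Matrix (Fin 2 × Fin 2) (Fin 2 × Fin 2) ℂ) :
    (filtered ρ A B * Y).trace = (ρ * ((A ⊗ₖ B) * Y * (A ⊗ₖ B)ᴴ)).trace := by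
  rw [filtered, Matrix.mul_assoc, Matrix.mul_assoc, trace_mul_comm]
  simp only [Matrix.mul_assoc]

/-- Up to the factor `½`, the witness is the partial transpose of `|ε⟩⟨ε|`. Transposing the first
factor conjugates the filter on that side, hence `A.map star`. -/
theorem kronecker_mul_singletWitness_mul (A : Matrix α (Fin 2) ℂ) (B : Matrix β (Fin 2) ℂ) :
    (A ⊗ₖ B) * singletWitness * (A ⊗ₖ B)ᴴ =
      (1 / 2 : ℝ) • partialTransposeRankOne (A.map star * antisymForm * Bᵀ) := by
  ext ⟨x, y⟩ ⟨x', y'⟩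
  simp [singletWitness, phi2, partialTransposeRankOne, antisymForm, mul_apply,
    Fintype.sum_prod_type, Fin.sum_univ_two, one_apply, kroneckerMap_apply]
  ring

variable [Fintype α] [Fintype β]

/-- The bipartite matrices `w` of unit Hilbert–Schmidt norm and of rank at most two. -/
def unitRankLeTwo (α β : Type*) [Fintype α] [Fintype β] : Set (Matrix α β ℂ) :=
  {w | ∑ i, ∑ j, ‖w i j‖ ^ 2 = 1 ∧ w.rank ≤ 2}

/-- Lower semicontinuity of the rank: having rank at least `n + 1` is an open condition. -/
theorem isClosed_setOf_matrix_rank_le [DecidableEq β] (n : ℕ) :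
    IsClosed {w : Matrix α β ℂ | w.rank ≤ n} := by
  let T : Matrix α β ℂ →ₗ[ℂ] ((β → ℂ) →L[ℂ] (α → ℂ)) :=
    LinearMap.toContinuousLinearMap.toLinearMap ∘ₗ (toLin' : Matrix α β ℂ ≃ₗ[ℂ] _).toLinearMap
  have hT : Continuous T := T.continuous_of_finiteDimensional
  have hopen : IsOpen (T ⁻¹' {f | ((n + 1 : ℕ) : Cardinal) ≤ (f : (β → ℂ) →ₗ[ℂ] (α → ℂ)).rank}) :=
    (isOpen_setOfPred_nat_le_rank (n + 1)).preimage hT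
  have hset : {w : Matrix α β ℂ | w.rank ≤ n} =
      (T ⁻¹' {f | ((n + 1 : ℕ) : Cardinal) ≤ (f : (β → ℂ) →ₗ[ℂ] (α → ℂ)).rank})ᶜ := by
    ext w
    have h1 : (T w : (β → ℂ) →ₗ[ℂ] (α → ℂ)).rank = (w.rank : Cardinal) :=
      (Module.finrank_eq_rank ℂ w.mulVecLin.range).symm
    simp only [Set.mem_ofPred_eq, Set.mem_compl_iff, Set.mem_preimage, h1, Nat.cast_le]
    lia
  rw [hset]
  exact hopen.isClosed_compl

theorem isCompact_setOf_sum_norm_sq_eq_one :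
    IsCompact {w : Matrix α β ℂ | ∑ i, ∑ j, ‖w i j‖ ^ 2 = 1} := by
  have hclosed : IsClosed {w : Matrix α β ℂ | ∑ i, ∑ j, ‖w i j‖ ^ 2 = 1} :=
    isClosed_eq (by fun_prop) continuous_const
  refine IsCompact.of_isClosed_subset
    (isCompact_univ_pi fun _ : α => isCompact_univ_pi fun _ : β =>
      isCompact_closedBall (0 : ℂ) 1) hclosed ?_
  intro w hw i _ j _
  have h1 : ‖w i j‖ ^ 2 ≤ ∑ i, ∑ j, ‖w i j‖ ^ 2 :=
    (Finset.single_le_sum (f := fun j => ‖w i j‖ ^ 2) (fun _ _ => by positivity)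
      (Finset.mem_univ j)).trans
    (Finset.single_le_sum (f := fun i => ∑ j, ‖w i j‖ ^ 2) (fun _ _ => by positivity)
      (Finset.mem_univ i))
  rw [show ∑ i, ∑ j, ‖w i j‖ ^ 2 = 1 from hw] at h1
  simpa using (sq_le_one_iff₀ (norm_nonneg _)).1 h1

theorem isCompact_unitRankLeTwo [DecidableEq β] : IsCompact (unitRankLeTwo α β) :=
  isCompact_setOf_sum_norm_sq_eq_one.inter_right (isClosed_setOf_matrix_rank_le 2)

end

/-! ### States: compactness and self-duality of the positive cone -/

section

variable {κ : Type*} [Fintype κ]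

/-- Parametrises states by the Hilbert–Schmidt unit sphere, which gives their compactness. -/
theorem isState_conjTranspose_mul_self_iff (B : Matrix κ κ ℂ) :
    IsState (Bᴴ * B) ↔ ∑ i, ∑ j, ‖B i j‖ ^ 2 = 1 := by
  have h : (Bᴴ * B).trace = ((∑ i, ∑ j, ‖B i j‖ ^ 2 : ℝ) : ℂ) := by
    simp only [trace, diag_apply, mul_apply, conjTranspose_apply]
    rw [Finset.sum_comm]
    simp [Complex.conj_mul']
  rw [IsState, h]
  exact ⟨fun h => by exact_mod_cast h.2,
    fun h => ⟨posSemidef_conjTranspose_mul_self B, by exact_mod_cast h⟩⟩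

open scoped MatrixOrder in
theorem isCompact_setOf_isState : IsCompact {ρ : Matrix κ κ ℂ | IsState ρ} := by
  classical
  have : {ρ : Matrix κ κ ℂ | IsState ρ} =
      (fun B : Matrix κ κ ℂ => Bᴴ * B) '' {B | ∑ i, ∑ j, ‖B i j‖ ^ 2 = 1} := by
    ext ρ
    constructor
    · intro h
      obtain ⟨B, rfl⟩ := CStarAlgebra.nonneg_iff_eq_star_mul_self.1 h.1.nonneg
      exact ⟨B, (isState_conjTranspose_mul_self_iff B).1 h, rfl⟩
    · rintro ⟨B, hB, rfl⟩
      exact (isState_conjTranspose_mul_self_iff B).2 hB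
  rw [this]
  exact isCompact_setOf_sum_norm_sq_eq_one.image (by fun_prop)

theorem isState_vecMulVec_star {x : κ → ℂ} (hx : ∑ i, ‖x i‖ ^ 2 = 1) :
    IsState (vecMulVec x (star x)) := by
  refine ⟨posSemidef_vecMulVec_self_star x, ?_⟩
  have : ((∑ i, ‖x i‖ ^ 2 : ℝ) : ℂ) = 1 := by exact_mod_cast hx
  simpa [trace, vecMulVec_apply, Complex.mul_conj'] using this

/-- A Hermitian matrix whose trace pairing with every state is nonnegative is positive. -/
theorem posSemidef_of_forall_isState {H : Matrix κ κ ℂ} (hH : H.IsHermitian)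
    (h : ∀ ρ, IsState ρ → 0 ≤ (H * ρ).trace.re) : H.PosSemidef := by
  refine PosSemidef.of_dotProduct_mulVec_nonneg hH fun x => ?_
  rw [Complex.nonneg_iff]
  refine ⟨?_, (hH.im_star_dotProduct_mulVec_self x).symm⟩
  have hpair : ∀ y : κ → ℂ, star y ⬝ᵥ H *ᵥ y = (H * vecMulVec y (star y)).trace := by
    intro y
    rw [mul_vecMulVec, trace_vecMulVec, dotProduct_comm]
  rcases eq_or_ne x 0 with rfl | hx
  · simp
  have hpos : 0 < ∑ i, ‖x i‖ ^ 2 := by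
    obtain ⟨i, hi⟩ := Function.ne_iff.1 hx
    refine Finset.sum_pos' (fun _ _ => by positivity) ⟨i, Finset.mem_univ i, ?_⟩
    have := norm_pos_iff.2 hi
    positivity
  set r := ∑ i, ‖x i‖ ^ 2
  have hst : IsState (vecMulVec ((√r)⁻¹ • x) (star ((√r)⁻¹ • x))) := by
    apply isState_vecMulVec_star
    simp only [Pi.smul_apply, norm_smul, mul_pow, ← Finset.mul_sum]
    rw [Real.norm_eq_abs, sq_abs, inv_pow, Real.sq_sqrt hpos.le, inv_mul_cancel₀ hpos.ne']
  have := h _ hst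
  rw [star_smul, smul_vecMulVec, vecMulVec_smul, smul_smul, mul_smul_comm, trace_smul,
    Complex.real_smul, star_trivial, Complex.re_ofReal_mul] at this
  rw [hpair]
  exact nonneg_of_mul_nonneg_right this (by positivity)

end

/-! ### Dual cone of the single-copy undistillable states -/

section

variable {α β : Type*} [Fintype α] [Fintype β] [DecidableEq α] [DecidableEq β]

/-- Unit-trace operators that generate, together, the cone dual to the single-copy undistillable
states. -/
def dualGenerators (α β : Type*) [Fintype α] [Fintype β] : Set (Matrix (α × β) (α × β) ℂ) :=
  partialTransposeRankOne '' unitRankLeTwo α β ∪ {ρ | IsState ρ}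

theorem isHermitian_of_mem_convexHull {κ : Type*} {S : Set (Matrix κ κ ℂ)}
    (hS : ∀ Y ∈ S, Y.IsHermitian) : ∀ Y ∈ convexHull ℝ S, Y.IsHermitian := by
  have : Convex ℝ {Y : Matrix κ κ ℂ | Y.IsHermitian} := by
    intro Y hY Z hZ a b _ _ _
    simp only [Set.mem_ofPred_eq, IsHermitian] at hY hZ ⊢
    simp [conjTranspose_smul, hY, hZ]
  exact convexHull_min hS this

/-- The matrix `w` attached to the filters factors through `ℂ²`, so its rank is at most two; after
normalisation the hypothesis applies. -/
theorem filtered_witness_nonneg {H : Matrix (α × β) (α × β) ℂ}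
    (h : ∀ w ∈ unitRankLeTwo α β, 0 ≤ (H * partialTransposeRankOne w).trace.re)
    (A : Matrix α (Fin 2) ℂ) (B : Matrix β (Fin 2) ℂ) :
    0 ≤ (filtered H A B * singletWitness).trace.re := by
  rw [trace_filtered_mul, kronecker_mul_singletWitness_mul, mul_smul_comm, trace_smul,
    Complex.real_smul, Complex.re_ofReal_mul]
  refine mul_nonneg (by norm_num) ?_
  set w := A.map star * antisymForm * Bᵀ with hwdef
  rcases eq_or_ne w 0 with hw | hw
  · rw [hw]
    simp [partialTransposeRankOne, Matrix.mul_apply, trace]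
  have hpos : 0 < ∑ i, ∑ j, ‖w i j‖ ^ 2 := by
    obtain ⟨i, hi⟩ := Function.ne_iff.1 hw
    obtain ⟨j, hj⟩ := Function.ne_iff.1 hi
    refine Finset.sum_pos' (fun _ _ => by positivity) ⟨i, Finset.mem_univ i, ?_⟩
    refine Finset.sum_pos' (fun _ _ => by positivity) ⟨j, Finset.mem_univ j, ?_⟩
    have := norm_pos_iff.2 hj
    positivity
  set r := ∑ i, ∑ j, ‖w i j‖ ^ 2
  have hmem : (√r)⁻¹ • w ∈ unitRankLeTwo α β := by
    constructor
    · simp only [Matrix.smul_apply, norm_smul, mul_pow, ← Finset.mul_sum]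
      rw [Real.norm_eq_abs, sq_abs, inv_pow, Real.sq_sqrt hpos.le, inv_mul_cancel₀ hpos.ne']
    · rw [hwdef, ← Matrix.smul_mul]
      exact (rank_mul_le_left _ _).trans
        ((rank_le_card_width _).trans (Fintype.card_fin 2).le)
  have := h _ hmem
  rw [partialTransposeRankOne_smul, mul_smul_comm, trace_smul, Complex.real_smul,
    Complex.re_ofReal_mul] at this
  exact nonneg_of_mul_nonneg_right this (by positivity)

/-- Duality for single-copy undistillable states. -/
theorem mem_convexHull_dualGenerators {X : Matrix (α × β) (α × β) ℂ} (hX : X.IsHermitian)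
    (hX1 : X.trace = 1)
    (h : ∀ ρ, IsState ρ → (∀ A B, 0 ≤ (filtered ρ A B * singletWitness).trace.re) →
      0 ≤ (X * ρ).trace.re) :
    X ∈ convexHull ℝ (dualGenerators α β) := by
  by_contra hXS
  have hcompact : IsCompact (convexHull ℝ (dualGenerators α β)) :=
    isCompact_convexHull_of_finiteDimensional
      ((isCompact_unitRankLeTwo.image continuous_partialTransposeRankOne).union
        isCompact_setOf_isState)
  have hherm : ∀ Y ∈ dualGenerators α β, Y.IsHermitian := by
    rintro _ (⟨w, -, rfl⟩ | hY)
    · exact partialTransposeRankOne_isHermitian w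
    · exact hY.1.1
  have htrace : ∀ Y ∈ dualGenerators α β, Y.trace = 1 := by
    rintro _ (⟨w, hw, rfl⟩ | hY)
    · rw [trace_partialTransposeRankOne, hw.1, Complex.ofReal_one]
    · exact hY.2
  obtain ⟨K, u, hK, hKX, hKS⟩ := exists_isHermitian_trace_separation
    (convex_convexHull ℝ (dualGenerators α β)) hcompact.isClosed
    (isHermitian_of_mem_convexHull hherm) hX hXS
  -- Generators and `X` all have trace one, so subtracting `u • 1` moves the separating threshold to
  -- `0`. Normalised, `H` becomes an undistillable state on which `X` is negative.
  set H : Matrix (α × β) (α × β) ℂ := K - u • 1 with hHdef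
  have hHtr : ∀ Y : Matrix (α × β) (α × β) ℂ, Y.trace = 1 →
      (H * Y).trace.re = (K * Y).trace.re - u := by
    intro Y hY
    simp [hHdef, sub_mul, trace_sub, trace_smul, hY]
  have hH : H.IsHermitian := by
    simp [hHdef, IsHermitian, conjTranspose_smul, hK.eq]
  have hHS : ∀ Y ∈ dualGenerators α β, 0 ≤ (H * Y).trace.re := by
    intro Y hY
    rw [hHtr Y (htrace Y hY)]
    linarith [hKS Y (subset_convexHull ℝ _ hY)]
  have hpsd : H.PosSemidef := posSemidef_of_forall_isState hH fun ρ hρ => hHS ρ (Or.inr hρ)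
  have hHX : (H * X).trace.re < 0 := by
    rw [hHtr X hX1]
    linarith
  have hne : H.trace ≠ 0 := by
    intro h0
    rw [hpsd.trace_eq_zero_iff.1 h0] at hHX
    simp at hHX
  have hpos : 0 < H.trace := lt_of_le_of_ne hpsd.trace_nonneg hne.symm
  obtain ⟨hre, him⟩ := Complex.pos_iff.1 hpos
  have hHtrace : H.trace = (H.trace.re : ℂ) := Complex.ext (by simp) (by simp [← him])
  set r := H.trace.re
  have hstate : IsState (r⁻¹ • H) := by
    refine ⟨hpsd.smul (by positivity), ?_⟩
    rw [trace_smul, hHtrace, Complex.real_smul, ← Complex.ofReal_mul, inv_mul_cancel₀ hre.ne',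
      Complex.ofReal_one]
  have hfin := h _ hstate fun A B => by
    have := filtered_witness_nonneg (fun w hw => hHS _ (Or.inl ⟨w, hw, rfl⟩)) A B
    rw [filtered, Matrix.mul_smul, Matrix.smul_mul, Matrix.smul_mul, trace_smul, Complex.real_smul,
      Complex.re_ofReal_mul]
    exact mul_nonneg (by positivity) this
  rw [mul_smul_comm, trace_smul, Complex.real_smul, Complex.re_ofReal_mul, trace_mul_comm] at hfin
  have := mul_neg_of_pos_of_neg (inv_pos.2 hre) hHX
  linarith

end

/-! ### Antisymmetry in the qubits and product vectors -/

section

variable {δ : Type*} [Fintype δ]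

/-- The partial trace over the two qubits, after multiplication by `𝟙 ⊗ T`. -/
noncomputable def qubitPairing (T : Matrix (Fin 2 × Fin 2) (Fin 2 × Fin 2) ℂ) :
    Matrix ((δ × Fin 2) × (δ × Fin 2)) ((δ × Fin 2) × (δ × Fin 2)) ℂ →ₗ[ℝ]
      Matrix (δ × δ) (δ × δ) ℂ where
  toFun Y := of fun x y => ∑ s : Fin 2 × Fin 2, ∑ t : Fin 2 × Fin 2,
    Y ((x.1, s.1), (x.2, s.2)) ((y.1, t.1), (y.2, t.2)) * T t s
  map_add' Y Z := by
    ext x y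
    simp [add_mul, Finset.sum_add_distrib]
  map_smul' c Y := by
    ext x y
    simp [mul_assoc, Finset.mul_sum]

omit [Fintype δ] in
theorem qubitPairing_bipartiteTensor (T S : Matrix (Fin 2 × Fin 2) (Fin 2 × Fin 2) ℂ)
    (σ : Matrix (δ × δ) (δ × δ) ℂ) :
    qubitPairing T (bipartiteTensor σ S) = (S * T).trace • σ := by
  ext x y
  simp only [qubitPairing, bipartiteTensor, LinearMap.coe_mk, AddHom.coe_mk, of_apply,
    reindex_apply, submatrix_apply, Equiv.prodProdProdComm_symm, Equiv.prodProdProdComm_apply,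
    kroneckerMap_apply, trace, diag_apply, mul_apply, Matrix.smul_apply, smul_eq_mul, Finset.sum_mul]
  refine Finset.sum_congr rfl fun s _ => Finset.sum_congr rfl fun t _ => ?_
  ring

theorem trace_singletWitness : singletWitness.trace = 1 := by
  simp [singletWitness, phi2, trace, Fintype.sum_prod_type]
  norm_num

/-- The two factors are partial transposes of the antisymmetric projector and of twice the symmetric
one; partial transposition preserves the trace pairing. -/
theorem trace_singletWitness_mul_eq_zero :
    (singletWitness * (1 + (2 : ℂ) • phi2)).trace = 0 := by
  simp [singletWitness, phi2, trace, Fintype.sum_prod_type, Fin.sum_univ_two, mul_apply, one_apply]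

/-- The functional `Y ↦ tr[Y (𝟙 ⊗ (𝟙 + 2 φ₂))]`. -/
noncomputable def symmetricFunctional :
    Matrix ((δ × Fin 2) × (δ × Fin 2)) ((δ × Fin 2) × (δ × Fin 2)) ℂ →ₗ[ℝ] ℝ :=
  Complex.reLm ∘ₗ (traceLinearMap (δ × δ) ℝ ℂ) ∘ₗ qubitPairing (1 + (2 : ℂ) • phi2)

theorem symmetricFunctional_apply
    (Y : Matrix ((δ × Fin 2) × (δ × Fin 2)) ((δ × Fin 2) × (δ × Fin 2)) ℂ) :
    symmetricFunctional Y = ∑ p, ∑ q, ((∑ a, ∑ b, Y ((p, a), (q, b)) ((p, a), (q, b))) +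
      ∑ a, ∑ b, Y ((p, a), (q, a)) ((p, b), (q, b))).re := by
  simp only [symmetricFunctional, LinearMap.comp_apply, Complex.reLm_coe, traceLinearMap_apply,
    trace, Fintype.sum_prod_type, Complex.re_sum]
  refine Finset.sum_congr rfl fun p _ => Finset.sum_congr rfl fun q _ => congrArg Complex.re ?_
  simp [qubitPairing, phi2, Fintype.sum_prod_type, Fin.sum_univ_two, one_apply]
  ring

/-- Moving the partial transpose onto `𝟙 + 2 φ₂` gives `𝟙` plus the qubit swap, which symmetrises
`w`. -/
theorem symmetricFunctional_partialTransposeRankOne (w : Matrix (δ × Fin 2) (δ × Fin 2) ℂ) :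
    symmetricFunctional (partialTransposeRankOne w) =
      ∑ p, ∑ q, (1 / 2) * ∑ a, ∑ b, ‖w (p, a) (q, b) + w (p, b) (q, a)‖ ^ 2 := by
  rw [symmetricFunctional_apply]
  refine Finset.sum_congr rfl fun p _ => Finset.sum_congr rfl fun q _ => ?_
  simp [partialTransposeRankOne, Fin.sum_univ_two, ← Complex.normSq_eq_norm_sq,
    Complex.normSq_apply]
  ring

theorem one_le_symmetricFunctional
    {ρ : Matrix ((δ × Fin 2) × (δ × Fin 2)) ((δ × Fin 2) × (δ × Fin 2)) ℂ} (hρ : IsState ρ) :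
    1 ≤ symmetricFunctional ρ := by
  have htr : (∑ p : δ, ∑ q : δ, (∑ a : Fin 2, ∑ b : Fin 2,
      ρ ((p, a), (q, b)) ((p, a), (q, b))).re) = 1 := by
    rw [← Complex.one_re, ← hρ.2, trace]
    simp only [Fintype.sum_prod_type, diag_apply, Complex.re_sum]
    refine Finset.sum_congr rfl fun p _ => ?_
    rw [Finset.sum_comm]
  rw [symmetricFunctional_apply]
  simp only [Complex.add_re, Finset.sum_add_distrib]
  rw [htr]
  refine le_add_of_nonneg_right (Finset.sum_nonneg fun p _ => Finset.sum_nonneg fun q _ => ?_)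
  -- The `φ₂` term is the expectation in the all-ones vector on the basis `|cc⟩`, with `p` and `q`
  -- fixed.
  have := (hρ.1.submatrix fun c : Fin 2 => ((p, c), (q, c))).dotProduct_mulVec_nonneg 1
  simpa [dotProduct, mulVec] using (Complex.nonneg_iff.1 this).1

/-- If `V ⊗ ε` has rank at most two, `ε` antisymmetric, then the `2 × 2` minors of `V` vanish. -/
theorem minor_eq_zero_of_rank_le_two {w : Matrix (δ × Fin 2) (δ × Fin 2) ℂ} {v : Matrix δ δ ℂ}
    (hw : ∀ p a q b, w (p, a) (q, b) = v p q * antisymForm a b) (hr : w.rank ≤ 2) (p p' q q' : δ) :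
    v p q * v p' q' = v p q' * v p' q := by
  by_contra hne
  let V : Matrix (Fin 2) (Fin 2) ℂ := !![v p q, v p q'; v p' q, v p' q']
  let f : Fin 2 × Fin 2 → δ × Fin 2 := fun s => (![p, p'] s.1, s.2)
  let g : Fin 2 × Fin 2 → δ × Fin 2 := fun s => (![q, q'] s.1, s.2)
  have hsub : w.submatrix f g = V ⊗ₖ antisymForm := by
    ext ⟨i, a⟩ ⟨j, b⟩
    simp only [submatrix_apply, f, g, hw, kroneckerMap_apply, V]
    fin_cases i <;> fin_cases j <;> rfl
  -- An invertible `4 × 4` submatrix contradicts rank at most two; its determinant is `(det V)² (det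
  -- ε)²`.
  have hunit : IsUnit (w.submatrix f g) := by
    rw [isUnit_iff_isUnit_det, hsub, det_kronecker, isUnit_iff_ne_zero]
    have hV : V.det ≠ 0 := by
      simpa [V, det_fin_two, sub_eq_zero] using hne
    simpa [antisymForm, det_fin_two] using hV
  have h4 := rank_of_isUnit _ hunit
  have hle : (w.submatrix f g).rank ≤ w.rank := rank_submatrix_le _ _ _
  simp at h4
  lia

/-- Vanishing minors make `v` the product of its column `q₀` and row `p₀`, divided by the pivot `v
p₀ q₀`. These, normalised, span the two states; the column is conjugated because of the partial
transpose. -/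
theorem exists_product_state {v : Matrix δ δ ℂ}
    (hv : ∀ p p' q q', v p q * v p' q' = v p q' * v p' q) (h1 : ∑ p, ∑ q, ‖v p q‖ ^ 2 = 1 / 2) :
    ∃ ρA ρB : Matrix δ δ ℂ, IsState ρA ∧ IsState ρB ∧
      ∀ p q p' q', 2 * (v p' q * star (v p q')) = (ρA ⊗ₖ ρB) (p, q) (p', q') := by
  obtain ⟨p₀, q₀, h0⟩ : ∃ p₀ q₀, v p₀ q₀ ≠ 0 := by
    by_contra! hall
    simp [hall] at h1
  set a := ∑ p, ‖v p q₀‖ ^ 2 with ha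
  set b := ∑ q, ‖v p₀ q‖ ^ 2 with hb
  have hD : 0 < ‖v p₀ q₀‖ ^ 2 := by
    have := norm_pos_iff.2 h0
    positivity
  have hapos : 0 < a :=
    Finset.sum_pos' (fun _ _ => by positivity) ⟨p₀, Finset.mem_univ _, hD⟩
  have hbpos : 0 < b :=
    Finset.sum_pos' (fun _ _ => by positivity) ⟨q₀, Finset.mem_univ _, hD⟩
  have hab : a * b = ‖v p₀ q₀‖ ^ 2 / 2 := by
    rw [div_eq_mul_one_div, ← h1, ha, hb, Finset.sum_mul_sum, Finset.mul_sum]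
    refine Finset.sum_congr rfl fun p _ => ?_
    rw [Finset.mul_sum]
    refine Finset.sum_congr rfl fun q _ => ?_
    rw [← mul_pow, ← mul_pow, ← norm_mul, ← norm_mul, hv p p₀ q₀ q, mul_comm]
  have hstate : ∀ (x : δ → ℂ) (c : ℝ), 0 < c → ∑ i, ‖x i‖ ^ 2 = c →
      IsState (vecMulVec ((√c)⁻¹ • x) (star ((√c)⁻¹ • x))) := by
    intro x c hc hx
    apply isState_vecMulVec_star
    simp only [Pi.smul_apply, norm_smul, mul_pow, ← Finset.mul_sum]
    rw [Real.norm_eq_abs, sq_abs, inv_pow, Real.sq_sqrt hc.le, hx, inv_mul_cancel₀ hc.ne']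
  refine ⟨_, _, hstate (fun p => star (v p q₀)) a hapos (by simp [ha]),
    hstate (fun q => v p₀ q) b hbpos rfl, fun p q p' q' => ?_⟩
  have hsq : ∀ c : ℝ, 0 < c → (((√c)⁻¹ : ℝ) : ℂ) * (((√c)⁻¹ : ℝ) : ℂ) = (c : ℂ)⁻¹ := by
    intro c hc
    rw [← Complex.ofReal_mul, ← mul_inv, Real.mul_self_sqrt hc.le, Complex.ofReal_inv]
  have hentry : ((vecMulVec ((√a)⁻¹ • fun p => star (v p q₀))
        (star ((√a)⁻¹ • fun p => star (v p q₀)))) ⊗ₖ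
      (vecMulVec ((√b)⁻¹ • fun q => v p₀ q) (star ((√b)⁻¹ • fun q => v p₀ q))))
        (p, q) (p', q') =
      ((a : ℂ)⁻¹ * (b : ℂ)⁻¹) * ((v p' q₀ * v p₀ q) * star (v p q₀ * v p₀ q')) := by
    rw [← hsq a hapos, ← hsq b hbpos]
    simp [kroneckerMap_apply, vecMulVec_apply]
    ring
  have hab' : (a : ℂ) * b = v p₀ q₀ * star (v p₀ q₀) / 2 := by
    rw [← Complex.ofReal_mul, hab]
    simp [Complex.mul_conj']
  have hstar : star (v p₀ q₀) ≠ 0 := star_ne_zero.2 h0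
  rw [hentry, hv p' p₀ q₀ q, hv p p₀ q₀ q', ← mul_inv, hab', star_mul]
  field_simp

/-- A unit vector of Schmidt rank at most two, antisymmetric in the qubits, is a product vector
tensor the singlet. -/
theorem exists_product_state_of_symmetricFunctional_eq_zero
    {w : Matrix (δ × Fin 2) (δ × Fin 2) ℂ} (hw : w ∈ unitRankLeTwo (δ × Fin 2) (δ × Fin 2))
    (h : symmetricFunctional (partialTransposeRankOne w) = 0) :
    ∃ ρA ρB : Matrix δ δ ℂ, IsState ρA ∧ IsState ρB ∧
      qubitPairing 1 (partialTransposeRankOne w) = ρA ⊗ₖ ρB := by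
  have hanti : ∀ p q a b, w (p, a) (q, b) = - w (p, b) (q, a) := by
    intro p q a b
    rw [symmetricFunctional_partialTransposeRankOne,
      Finset.sum_eq_zero_iff_of_nonneg (fun _ _ => by positivity)] at h
    have h1 := h p (Finset.mem_univ p)
    rw [Finset.sum_eq_zero_iff_of_nonneg (fun _ _ => by positivity)] at h1
    have h2 := (mul_eq_zero.1 (h1 q (Finset.mem_univ q))).resolve_left (by norm_num)
    rw [Finset.sum_eq_zero_iff_of_nonneg (fun _ _ => by positivity)] at h2
    have h3 := h2 a (Finset.mem_univ a)
    rw [Finset.sum_eq_zero_iff_of_nonneg (fun _ _ => by positivity)] at h3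
    have h4 := h3 b (Finset.mem_univ b)
    exact eq_neg_of_add_eq_zero_left (norm_eq_zero.1 (pow_eq_zero_iff two_ne_zero |>.1 h4))
  let v : Matrix δ δ ℂ := of fun p q => w (p, 0) (q, 1)
  have hwv : ∀ p a q b, w (p, a) (q, b) = v p q * antisymForm a b := by
    intro p a q b
    have hdiag : ∀ c, w (p, c) (q, c) = 0 := fun c => self_eq_neg.1 (hanti p q c c)
    fin_cases a <;> fin_cases b <;> simp [v, antisymForm, hdiag, hanti p q 1 0]
  -- The form `ε` has squared norm `2`.
  have hnorm : ∑ p, ∑ q, ‖v p q‖ ^ 2 = 1 / 2 := by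
    have := hw.1
    simp only [Fintype.sum_prod_type, hwv] at this
    simp [Fin.sum_univ_two, antisymForm, Finset.sum_add_distrib] at this
    linarith
  obtain ⟨ρA, ρB, hA, hB, hv⟩ :=
    exists_product_state (minor_eq_zero_of_rank_le_two hwv hw.2) hnorm
  refine ⟨ρA, ρB, hA, hB, ?_⟩
  ext ⟨p, q⟩ ⟨p', q'⟩
  rw [← hv]
  simp [qubitPairing, partialTransposeRankOne, Fintype.sum_prod_type, Fin.sum_univ_two, hwv,
    antisymForm, one_apply]
  ring

omit [Fintype δ] in
theorem bipartiteTensor_isHermitian {σ : Matrix (δ × δ) (δ × δ) ℂ}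
    {S : Matrix (Fin 2 × Fin 2) (Fin 2 × Fin 2) ℂ} (hσ : σ.IsHermitian) (hS : S.IsHermitian) :
    (bipartiteTensor σ S).IsHermitian := by
  rw [IsHermitian, bipartiteTensor, conjTranspose_reindex, conjTranspose_kronecker, hσ.eq, hS.eq]

theorem trace_bipartiteTensor (σ : Matrix (δ × δ) (δ × δ) ℂ)
    (S : Matrix (Fin 2 × Fin 2) (Fin 2 × Fin 2) ℂ) :
    (bipartiteTensor σ S).trace = σ.trace * S.trace := by
  rw [← trace_kronecker, bipartiteTensor, reindex_apply, trace, trace]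
  exact Equiv.sum_comp _ fun i => (σ ⊗ₖ S) i i

theorem singletWitness_isHermitian : singletWitness.IsHermitian := by
  ext x y
  simp [singletWitness, phi2, one_apply, eq_comm, and_comm, apply_ite star]

/-- If `σ ⊗ (½ 𝟙 - φ₂)` is nonnegative on the single-copy undistillable states, then `σ` is
separable. -/
theorem isSeparable_of_forall_undistillable [DecidableEq δ] {σ : Matrix (δ × δ) (δ × δ) ℂ}
    (hσ : IsState σ)
    (h : ∀ ρ, IsState ρ → (∀ A B, 0 ≤ (filtered ρ A B * singletWitness).trace.re) →
      0 ≤ (bipartiteTensor σ singletWitness * ρ).trace.re) :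
    IsSeparable σ := by
  have hX := mem_convexHull_dualGenerators
    (bipartiteTensor_isHermitian hσ.1.1 singletWitness_isHermitian)
    (by rw [trace_bipartiteTensor, hσ.2, trace_singletWitness, mul_one]) h
  have hX0 : symmetricFunctional (bipartiteTensor σ singletWitness) = 0 := by
    simp [symmetricFunctional, qubitPairing_bipartiteTensor, trace_singletWitness_mul_eq_zero]
  have hnonneg : ∀ Y ∈ dualGenerators (δ × Fin 2) (δ × Fin 2), 0 ≤ symmetricFunctional Y := by
    rintro _ (⟨w, -, rfl⟩ | hY)
    · rw [symmetricFunctional_partialTransposeRankOne]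
      positivity
    · exact zero_le_one.trans (one_le_symmetricFunctional hY)
  -- Only generators killed by the functional occur in `X`. Tracing out the qubits sends `X` to `σ`,
  -- since the witness has trace one.
  have hmem := Set.mem_image_of_mem (qubitPairing 1)
    (mem_convexHull_inter_zero symmetricFunctional hnonneg hX hX0)
  rw [qubitPairing_bipartiteTensor, mul_one, trace_singletWitness, one_smul,
    (qubitPairing 1).image_convexHull] at hmem
  refine convexHull_mono ?_ hmem
  rintro _ ⟨_, ⟨⟨w, hw, rfl⟩ | hY, h0⟩, rfl⟩
  · exact exists_product_state_of_symmetricFunctional_eq_zero hw h0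
  · have := one_le_symmetricFunctional hY
    rw [Set.mem_ofPred_eq] at h0
    linarith

end

/-! ### Filter criterion for undistillability -/

section

variable {α β : Type*} [Fintype α] [Fintype β]

theorem trace_mul_singletWitness_re (M : Matrix (Fin 2 × Fin 2) (Fin 2 × Fin 2) ℂ) :
    (M * singletWitness).trace.re = M.trace.re / 2 - (M * phi2).trace.re := by
  rw [singletWitness, mul_sub, trace_sub, mul_smul_comm, mul_one, trace_smul, Complex.sub_re]
  simp
  ring

/-- A state is single-copy undistillable if all of its local filterings to two qubits pair
nonnegatively with `½ 𝟙 - φ₂`. -/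
theorem mem_singleCopyUndistillable [DecidableEq α] [DecidableEq β]
    {ρ : Matrix (α × β) (α × β) ℂ} (hρ : IsState ρ)
    (h : ∀ A B, 0 ≤ (filtered ρ A B * singletWitness).trace.re) :
    ρ ∈ singleCopyUndistillable α β := by
  refine ⟨hρ, IsGreatest.csSup_eq ⟨?_, ?_⟩⟩
  -- The value `½` is attained: filtering onto a product basis vector of nonzero weight leaves a
  -- multiple of `|00⟩⟨00|`, whose overlap with `φ₂` is `½`.
  · obtain ⟨⟨a, b⟩, hab⟩ : ∃ x, ρ x x ≠ 0 := by
      by_contra! hall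
      have := hρ.2
      simp [trace, hall] at this
    have hentry : ∀ s t, filtered ρ (Matrix.single a (0 : Fin 2) 1) (Matrix.single b (0 : Fin 2) 1)
        s t = if s = (0, 0) ∧ t = (0, 0) then ρ (a, b) (a, b) else 0 := by
      rintro ⟨s₁, s₂⟩ ⟨t₁, t₂⟩
      rw [filtered, single_kronecker_single, conjTranspose_single]
      simp [Matrix.single_apply, eq_comm]
    have htr : (filtered ρ (Matrix.single a (0 : Fin 2) 1)
        (Matrix.single b (0 : Fin 2) 1)).trace = ρ (a, b) (a, b) := by
      simp [trace, hentry]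
    have hphi : (filtered ρ (Matrix.single a (0 : Fin 2) 1)
        (Matrix.single b (0 : Fin 2) 1) * phi2).trace = ρ (a, b) (a, b) * (1 / 2 : ℝ) := by
      simp [trace, mul_apply, hentry, phi2, Fintype.sum_prod_type, Fin.sum_univ_two]
    refine ⟨_, _, htr ▸ hab, ?_⟩
    have hre : (ρ (a, b) (a, b)).re ≠ 0 := by
      intro h0
      refine hab (Complex.ext h0 ?_)
      exact (Complex.nonneg_iff.1 (hρ.1.diag_nonneg (i := (a, b)))).2.symm
    rw [hphi, htr, Complex.re_mul_ofReal]
    field_simp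
  · rintro r ⟨A, B, hne, rfl⟩
    have hpos : 0 < (filtered ρ A B).trace :=
      lt_of_le_of_ne (hρ.1.conjTranspose_mul_mul_same _).trace_nonneg hne.symm
    rw [div_le_iff₀ (Complex.pos_iff.1 hpos).1]
    have := h A B
    rw [trace_mul_singletWitness_re] at this
    linarith

end

/-! ### One copy of a state hidden among `k` tensor factors -/

section

variable {κ : Type*} [DecidableEq κ] {k : ℕ}

/-- The isometry that places a vector in the `i`-th of `k` tensor factors, all other factors being
in the basis state `c`. -/
def placeAt (c : κ) (i : Fin k) : Matrix (Fin k → κ) κ ℂ :=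
  of fun f x => if f = Function.update (fun _ => c) i x then 1 else 0

/-- The operator `ρ` in the `i`-th of `k` tensor factors, all others being in the state `c`. -/
noncomputable def singleCopy [Fintype κ] (c : κ) (i : Fin k) (ρ : Matrix κ κ ℂ) :
    Matrix (Fin k → κ) (Fin k → κ) ℂ :=
  placeAt c i * ρ * (placeAt c i)ᴴ

/-- The uniform mixture of the placements of `ρ` in one of `k` tensor factors, all others being in
the state `c`. -/
noncomputable def mixedCopies [Fintype κ] (k : ℕ) (c : κ) (ρ : Matrix κ κ ℂ) :
    Matrix (Fin k → κ) (Fin k → κ) ℂ :=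
  (k : ℝ)⁻¹ • ∑ i, singleCopy c i ρ

variable [Fintype κ]

theorem isState_smul_sum [NeZero k] {ν : Type*} [Fintype ν] {τ : Fin k → Matrix ν ν ℂ}
    (h : ∀ i, IsState (τ i)) : IsState ((k : ℝ)⁻¹ • ∑ i, τ i) := by
  refine ⟨(posSemidef_sum _ fun i _ => (h i).1).smul (by positivity), ?_⟩
  have hk : (k : ℂ) ≠ 0 := Nat.cast_ne_zero.2 (NeZero.ne k)
  simp [trace_smul, trace_sum, fun i => (h i).2, hk]

theorem conjTranspose_placeAt_mul (c : κ) (i : Fin k) : (placeAt c i)ᴴ * placeAt c i = 1 := by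
  ext x y
  simp [placeAt, mul_apply, one_apply, (Function.update_injective _ _).eq_iff, apply_ite star,
    eq_comm]

theorem isState_singleCopy (c : κ) (i : Fin k) {ρ : Matrix κ κ ℂ} (hρ : IsState ρ) :
    IsState (singleCopy c i ρ) := by
  refine ⟨hρ.1.mul_mul_conjTranspose_same _, ?_⟩
  rw [singleCopy, trace_mul_comm, ← Matrix.mul_assoc, conjTranspose_placeAt_mul, Matrix.one_mul,
    hρ.2]

/-- All other factors carry the same `c`, so a permutation merely moves the distinguished place;
averaging over places is then symmetric. -/
theorem permOp_mul_placeAt (π : Equiv.Perm (Fin k)) (c : κ) (i : Fin k) :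
    (permOp π : Matrix (Fin k → κ) (Fin k → κ) ℂ) * placeAt c i = placeAt c (π i) := by
  ext f x
  have : (Function.update (fun _ => c) i x) ∘ π.symm =
      Function.update (fun _ => c) (π i) x := by
    rw [Function.update_comp_equiv]
    rfl
  simp [permOp, placeAt, mul_apply, this]

theorem mixedCopies_mem_symmetricStates [NeZero k] (c : κ) {ρ : Matrix κ κ ℂ} (hρ : IsState ρ) :
    mixedCopies k c ρ ∈ symmetricStates κ k := by
  refine ⟨isState_smul_sum fun i => isState_singleCopy c i hρ, fun π => ?_⟩
  have hπ : ∀ i, (permOp π : Matrix (Fin k → κ) (Fin k → κ) ℂ) * singleCopy c i ρ *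
      (permOp π)ᴴ = singleCopy c (π i) ρ := by
    intro i
    rw [singleCopy, singleCopy, ← permOp_mul_placeAt, conjTranspose_mul]
    simp only [Matrix.mul_assoc]
  rw [mixedCopies, Matrix.mul_smul, Matrix.smul_mul, Matrix.mul_sum, Matrix.sum_mul]
  simp only [hπ]
  rw [Equiv.sum_comp π fun i => singleCopy c i ρ]

theorem singleCopy_apply (c : κ) (i : Fin k) (ρ : Matrix κ κ ℂ) (f g : Fin k → κ) :
    singleCopy c i ρ f g = ∑ x, ∑ y, if f = Function.update (fun _ => c) i x then
      (if g = Function.update (fun _ => c) i y then ρ x y else 0) else 0 := by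
  simp only [singleCopy, placeAt, mul_apply, conjTranspose_apply, of_apply, Finset.sum_mul]
  rw [Finset.sum_comm]
  refine Finset.sum_congr rfl fun x _ => Finset.sum_congr rfl fun y _ => ?_
  split_ifs <;> simp

theorem marginal_smul_sum (m : Fin k) (r : ℝ)
    (τ : Fin k → Matrix (Fin k → κ) (Fin k → κ) ℂ) :
    marginal m (r • ∑ i, τ i) = r • ∑ i, marginal m (τ i) := by
  ext x y
  simp only [marginal, of_apply, Matrix.smul_apply, Matrix.sum_apply]
  rw [Finset.sum_comm, Finset.smul_sum]
  refine Finset.sum_congr rfl fun f _ => ?_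
  split_ifs <;> simp

theorem marginal_singleCopy_self (c : κ) (m : Fin k) (ρ : Matrix κ κ ℂ) :
    marginal m (singleCopy c m ρ) = ρ := by
  ext x y
  simp only [marginal, of_apply, singleCopy_apply]
  rw [Finset.sum_eq_single (Function.update (fun _ => c) m x)]
  · simp [(Function.update_injective _ _).eq_iff]
  · intro f _ hf
    rw [ite_eq_right_iff]
    intro hfx
    refine Finset.sum_eq_zero fun x' _ => Finset.sum_eq_zero fun y' _ => ?_
    rw [if_neg]
    rintro rfl
    simp only [Function.update_self] at hfx
    exact hf (by rw [hfx])
  · simp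

theorem marginal_singleCopy_of_ne (c : κ) {m i : Fin k} (hi : i ≠ m) (ρ : Matrix κ κ ℂ) :
    marginal m (singleCopy c i ρ) = ρ.trace • Matrix.single c c 1 := by
  -- Changing the `m`-th letter leaves a string of the placed form only if the new letter is again
  -- `c`.
  have key : ∀ x' y y' : κ, Function.update (Function.update (fun _ => c) i x') m y =
        Function.update (fun _ => c) i y' ↔ x' = y' ∧ c = y := by
    intro x' y y'
    constructor
    · intro h
      have h1 := congrFun h i
      have h2 := congrFun h m
      simp [hi, hi.symm] at h1 h2
      exact ⟨h1, h2.symm⟩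
    · rintro ⟨rfl, rfl⟩
      rw [Function.update_eq_self_iff]
      simp [hi.symm]
  ext x y
  simp only [marginal, of_apply, singleCopy_apply]
  have : ∀ f : Fin k → κ, (if f m = x then ∑ x', ∑ y',
      (if f = Function.update (fun _ => c) i x' then
        (if Function.update f m y = Function.update (fun _ => c) i y' then ρ x' y' else 0)
        else 0) else 0) =
      ∑ x', if f = Function.update (fun _ => c) i x' then
        (if c = x ∧ c = y then ρ x' x' else 0) else 0 := by
    intro f
    by_cases hf : f m = x
    · rw [if_pos hf]
      refine Finset.sum_congr rfl fun x' _ => ?_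
      by_cases hx' : f = Function.update (fun _ => c) i x'
      · subst hx'
        have hc : c = x := by simpa [hi.symm] using hf
        subst hc
        simp only [key]
        by_cases hy : c = y <;> simp [hy]
      · simp [hx']
    · rw [if_neg hf]
      refine (Finset.sum_eq_zero fun x' _ => ?_).symm
      by_cases hx' : f = Function.update (fun _ => c) i x'
      · subst hx'
        have hc : c ≠ x := by simpa [hi.symm] using hf
        simp [hc]
      · simp [hx']
  simp only [this]
  rw [Finset.sum_comm]
  simp [Matrix.single_apply, trace]

theorem isState_single (c : κ) : IsState (Matrix.single c c (1 : ℂ)) := by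
  have h := isState_vecMulVec_star (x := Pi.single c (1 : ℂ))
    (by simp [Pi.single_apply, apply_ite])
  rwa [Pi.star_single, star_one, ← Matrix.single_eq_single_vecMulVec_single] at h

theorem isState_marginal_mixedCopies [NeZero k] (c : κ) {ρ : Matrix κ κ ℂ} (hρ : IsState ρ)
    (m : Fin k) : IsState (marginal m (mixedCopies k c ρ)) := by
  rw [mixedCopies, marginal_smul_sum]
  refine isState_smul_sum fun i => ?_
  rcases eq_or_ne i m with rfl | hi
  · rwa [marginal_singleCopy_self]
  · rw [marginal_singleCopy_of_ne c hi, hρ.2, one_smul]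
    exact isState_single c

/-- Every placement away from `m` has marginal `|c⟩⟨c|`, and `X c c = 0` removes it. -/
theorem trace_mul_marginal_mixedCopies [NeZero k] (c : κ) {ρ X : Matrix κ κ ℂ} (hX : X c c = 0)
    (m : Fin k) : (X * marginal m (mixedCopies k c ρ)).trace.re =
      (k : ℝ)⁻¹ * (X * ρ).trace.re := by
  rw [mixedCopies, marginal_smul_sum, mul_smul_comm, trace_smul, Complex.real_smul,
    Complex.re_ofReal_mul, Matrix.mul_sum, trace_sum, Finset.sum_eq_single m,
    marginal_singleCopy_self]
  · intro i _ hi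
    rw [marginal_singleCopy_of_ne c hi, mul_smul_comm, trace_smul, trace_mul_single]
    simp [hX]
  · simp

end

/-! ### Undistillability of the mixture across the two parties -/

section

variable {ι : Type*} [Fintype ι] [DecidableEq ι] {k : ℕ}

omit [Fintype ι] [DecidableEq ι] in
theorem acrossParties_eq_submatrix (ω : Matrix (Fin k → ι × ι) (Fin k → ι × ι) ℂ) :
    acrossParties ω = ω.submatrix (Equiv.arrowProdEquivProdArrow (Fin k) (fun _ => ι)
      (fun _ => ι)).symm (Equiv.arrowProdEquivProdArrow (Fin k) (fun _ => ι) (fun _ => ι)).symm :=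
  rfl

omit [DecidableEq ι] in
theorem IsState.acrossParties {ω : Matrix (Fin k → ι × ι) (Fin k → ι × ι) ℂ}
    (h : IsState ω) : IsState (acrossParties ω) := by
  rw [acrossParties_eq_submatrix]
  exact ⟨h.1.submatrix _, (Equiv.sum_comp _ fun f => ω f f).trans h.2⟩

/-- Placing a copy among the product states `(e, e)` is a product of local isometries, which the
filters absorb. -/
theorem filtered_acrossParties_singleCopy (e : ι) (i : Fin k)
    (ρ : Matrix (ι × ι) (ι × ι) ℂ) (A B : Matrix (Fin k → ι) (Fin 2) ℂ) :
    filtered (acrossParties (singleCopy (e, e) i ρ)) A B =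
      filtered ρ (A.submatrix (Function.update (fun _ => e) i) id)
        (B.submatrix (Function.update (fun _ => e) i) id) := by
  let U : Matrix ((Fin k → ι) × (Fin k → ι)) (ι × ι) ℂ :=
    of fun F x => if F = (Function.update (fun _ => e) i x.1, Function.update (fun _ => e) i x.2)
      then 1 else 0
  have hU : acrossParties (singleCopy (e, e) i ρ) = U * ρ * Uᴴ := by
    have : U = (placeAt (e, e) i).submatrix (Equiv.arrowProdEquivProdArrow (Fin k) (fun _ => ι)
      (fun _ => ι)).symm id := by
      ext F x
      simp only [U, placeAt, of_apply, submatrix_apply, id]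
      congr 1
      rw [Equiv.symm_apply_eq, eq_iff_iff]
      have : (Equiv.arrowProdEquivProdArrow (Fin k) (fun _ => ι) (fun _ => ι))
          (Function.update (fun _ => (e, e)) i x) =
          (Function.update (fun _ => e) i x.1, Function.update (fun _ => e) i x.2) := by
        refine Prod.ext (funext fun j => ?_) (funext fun j => ?_) <;>
        · by_cases hj : j = i
          · subst hj
            simp
          · simp [hj]
      rw [this]
    rw [this]
    rfl
  have hAB : Uᴴ * (A ⊗ₖ B) = (A.submatrix (Function.update (fun _ => e) i) id) ⊗ₖ
      (B.submatrix (Function.update (fun _ => e) i) id) := by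
    ext x s
    simp [U, mul_apply, kroneckerMap_apply, apply_ite star]
  rw [filtered, filtered, hU, ← hAB, conjTranspose_mul, conjTranspose_conjTranspose]
  simp only [Matrix.mul_assoc]

/-- Mixing a single-copy undistillable state with a pure product state gives a copy-correlated
undistillable state. -/
theorem marginal_mixedCopies_mem [NeZero k] (e : ι) {ρ : Matrix (ι × ι) (ι × ι) ℂ}
    (hρ : IsState ρ) (h : ∀ A B, 0 ≤ (filtered ρ A B * singletWitness).trace.re) :
    marginal 0 (mixedCopies k (e, e) ρ) ∈ copyCorrelatedUndistillable ι k := by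
  have hsym := mixedCopies_mem_symmetricStates (k := k) (e, e) hρ
  refine ⟨isState_marginal_mixedCopies _ hρ 0, _, hsym,
    mem_singleCopyUndistillable hsym.1.acrossParties fun A B => ?_, rfl⟩
  have hlin : filtered (acrossParties (mixedCopies k (e, e) ρ)) A B =
      (k : ℝ)⁻¹ • ∑ i, filtered (acrossParties (singleCopy (e, e) i ρ)) A B := by
    have : acrossParties (mixedCopies k (e, e) ρ) =
        (k : ℝ)⁻¹ • ∑ i, acrossParties (singleCopy (e, e) i ρ) := by
      ext F G
      simp [acrossParties, mixedCopies, Matrix.sum_apply]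
    simp only [this, filtered, Matrix.mul_smul, Matrix.smul_mul, Matrix.mul_sum, Matrix.sum_mul]
  rw [hlin, Matrix.smul_mul, trace_smul, Complex.real_smul, Complex.re_ofReal_mul, Matrix.sum_mul,
    trace_sum, Complex.re_sum]
  -- For fixed filters the criterion is linear in the state, so it passes to mixtures.
  refine mul_nonneg (by positivity) (Finset.sum_nonneg fun i _ => ?_)
  rw [filtered_acrossParties_singleCopy]
  exact h _ _

end

end CopyCorrelated

theorem mainTheorem6 (d k : ℕ) [NeZero k]
    (σ : Matrix (Fin d × Fin d) (Fin d × Fin d) ℂ) (hσ : CopyCorrelated.IsState σ)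
    (h : CopyCorrelated.bipartiteTensor σ ((1 / 2 : ℂ) • 1 - CopyCorrelated.phi2) ∈
      CopyCorrelated.dualCone
        (CopyCorrelated.copyCorrelatedUndistillable (Fin d × Fin 2) k)) :
    CopyCorrelated.IsSeparable σ := by
  obtain ⟨p⟩ : Nonempty (Fin d) := by
    by_contra hd
    rw [not_nonempty_iff] at hd
    simpa [Matrix.trace] using hσ.2
  refine CopyCorrelated.isSeparable_of_forall_undistillable hσ fun ρ hρ hfil => ?_
  -- The diagonal entry of `½ 𝟙 - φ₂` at `|00⟩` is `½ - ½`, which is why both qubits of the filler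
  -- state are set to `0`.
  have hX : CopyCorrelated.bipartiteTensor σ CopyCorrelated.singletWitness
      ((p, 0), (p, 0)) ((p, 0), (p, 0)) = 0 := by
    simp [CopyCorrelated.bipartiteTensor, CopyCorrelated.singletWitness, CopyCorrelated.phi2]
  have hpair := h.2 _ (CopyCorrelated.marginal_mixedCopies_mem (k := k) (p, 0) hρ hfil)
  rw [← CopyCorrelated.singletWitness, CopyCorrelated.trace_mul_marginal_mixedCopies _ hX] at hpair
  exact nonneg_of_mul_nonneg_right hpair
    (inv_pos.2 (Nat.cast_pos.2 (Nat.pos_of_neZero k)))
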